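/- Let $d\ge 1$ and $n\ge 2$ be integers. A Transformer block with $h$ heads of size $m$ and $r$ hidden units is a map $\mathbb{R}^{d\times n}\to\mathbb{R}^{d\times n}$, $X\mapsto \mathrm{FF}(X)$, of the form $$\mathrm{Attn}(X)=X+\sum_{i=1}^{h}W_O^iW_V^iX\cdot\sigma\big[(W_K^iX)^{T}W_Q^iX\big],$$ $$\mathrm{FF}(X)=\mathrm{Attn}(X)+W_2\,\mathrm{ReLU}\big(W_1\mathrm{Attn}(X)+b_1\mathbf{1}_n^{T}\big)+b_2\mathbf{1}_n^{T},$$ where $W_O^i\in\mathbb{R}^{d\times m}$, $W_V^i,W_K^i,W_Q^i\in\mathbb{R}^{m\times d}$, $W_1\in\mathbb{R}^{r\times d}$, $W_2\in\mathbb{R}^{d\times r}$, $b_1\in\mathbb{R}^r$ and $b_2\in\mathbb{R}^d$ are arbitrary, $\sigma$ is the softmax applied to each column of a matrix, $\mathrm{ReLU}(t)=\max(t,0)$ is applied to each entry, and $\mathbf{1}_n$ is the all-ones vector of length $n$. Let $\mathcal{T}^{h,m,r}$ be the set of all finite compositions of such blocks (with $h,m,r$ fixed and possibly different parameters in each block).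 For $1\le p<\infty$ put $$\mathsf{d}_p(f_1,f_2)=\Big(\int_{\mathbb{R}^{d\times n}}\|f_1(X)-f_2(X)\|_p^p\,dX\Big)^{1/p},$$ where $\|A\|_p=\big(\sum_{i,j}|A_{i,j}|^p\big)^{1/p}$ is the entry-wise $\ell^p$ norm and $dX$ is Lebesgue measure. **Theorem.** Let $1\le p<\infty$ and $\epsilon>0$, and let $f:\mathbb{R}^{d\times n}\to\mathbb{R}^{d\times n}$ be continuous, compactly supported and permutation equivariant, that is, $f(XP)=f(X)P$ for all $X\in\mathbb{R}^{d\times n}$ and all $n\times n$ permutation matrices $P$. Then there exists $g\in\mathcal{T}^{2,1,4}$ such that $\mathsf{d}_p(f,g)\le\epsilon$. -/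

import Mathlib

open MeasureTheory

noncomputable section

namespace TransformerNet

/-- Sequences of `n` tokens in dimension `d`: real `d × n` matrices, one column per token. -/
abbrev Seq (d n : ℕ) : Type := Matrix (Fin d) (Fin n) ℝ

/-- Column-wise softmax of a matrix. -/
def softmax {k n : ℕ} (A : Matrix (Fin k) (Fin n) ℝ) : Matrix (Fin k) (Fin n) ℝ :=
  Matrix.of fun i j => Real.exp (A i j) / ∑ l, Real.exp (A l j)

/-- Entry-wise rectified linear unit. -/
def relu {k n : ℕ} (A : Matrix (Fin k) (Fin n) ℝ) : Matrix (Fin k) (Fin n) ℝ :=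
  A.map fun t => max t 0

/-- The parameters of a Transformer block on `d`-dimensional tokens with `h` attention heads of
size `m` and `r` hidden units. They do not depend on the sequence length. -/
structure BlockParams (d h m r : ℕ) where
  WO : Fin h → Matrix (Fin d) (Fin m) ℝ
  WV : Fin h → Matrix (Fin m) (Fin d) ℝ
  WK : Fin h → Matrix (Fin m) (Fin d) ℝ
  WQ : Fin h → Matrix (Fin m) (Fin d) ℝ
  W₁ : Matrix (Fin r) (Fin d) ℝ
  W₂ : Matrix (Fin d) (Fin r) ℝ
  b₁ : Fin r → ℝ
  b₂ : Fin d → ℝ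

variable {d n h m r : ℕ}

/-- The self-attention layer, with skip connection. -/
def attn (θ : BlockParams d h m r) (X : Seq d n) : Seq d n :=
  X + ∑ i, θ.WO i * (θ.WV i * X) * softmax ((θ.WK i * X).transpose * (θ.WQ i * X))

/-- The token-wise feed-forward layer, with skip connection.
Here `Matrix.vecMulVec b 1` is the outer product of `b` with the all-ones vector. -/
def feedForward (θ : BlockParams d h m r) (Y : Seq d n) : Seq d n :=
  Y + θ.W₂ * relu (θ.W₁ * Y + Matrix.vecMulVec θ.b₁ 1) + Matrix.vecMulVec θ.b₂ 1

/-- The map computed by a Transformer block. -/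
def block (θ : BlockParams d h m r) (X : Seq d n) : Seq d n :=
  feedForward θ (attn θ X)

/-- The Transformer networks with `h` heads of size `m` and `r` hidden units: all compositions
of finitely many (at least one) Transformer blocks. -/
inductive IsTransformer (d n h m r : ℕ) : (Seq d n → Seq d n) → Prop
  | single (θ : BlockParams d h m r) : IsTransformer d n h m r (block θ)
  | comp (θ : BlockParams d h m r) (g : Seq d n → Seq d n) (hg : IsTransformer d n h m r g) :
      IsTransformer d n h m r (block θ ∘ g)

/-- Permuting the columns of the input permutes the columns of the output in the same way. -/
def PermEquivariant (f : Seq d n → Seq d n) : Prop :=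
  ∀ (σ : Equiv.Perm (Fin n)) (X : Seq d n),
    f (X * σ.permMatrix ℝ) = f X * σ.permMatrix ℝ

/-- The entry-wise `ℓ^p` norm of a matrix. -/
def entryNorm (p : ℝ) (A : Seq d n) : ℝ :=
  (∑ i, ∑ j, |A i j| ^ p) ^ (1 / p)

/-- The `L^p` distance, with values in `[0, ∞]`, with respect to Lebesgue measure on the space of
`d × n` matrices (the product measure on the entries). -/
def lpDist (p : ℝ) (f₁ f₂ : Seq d n → Seq d n) : ENNReal :=
  (∫⁻ x : Fin d → Fin n → ℝ,
    ENNReal.ofReal (entryNorm p (f₁ (Matrix.of x) - f₂ (Matrix.of x)) ^ p)) ^ (1 / p)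

end TransformerNet

end

/-! After rescaling, cut the cube supporting `f` into `m` slices per axis; by uniform continuity `f`
is nearly constant on cells. Feed-forward blocks quantize each token and read its digits in base `m`
as an integer `a j` below `N = m ^ d`. A scalar network turns `a j` into `(n + 1) ^ a j`, and one
uniform attention layer adds `(n + 1) ^ N` times the sum of these powers over all tokens. The base
`n + 1` digits of that sum are multiplicities, so the result determines `a j` and the multiset of
all `a k` (`exists_perm_of_contextCode_eq`). By equivariance this fixes column `j` of the output,
which a token-wise network then interpolates (`exists_tokenNet_interpolate`).

Continuous networks quantize exactly only off strips of width `η`. The output bound in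
`exists_transformer_of_cells` does not depend on `η`, and the strips shrink to a null set
(`exists_volume_badSet_le`). Outside the grid the code overshoots every valid code and the output is
zero, so the global integral is controlled. -/

namespace TransformerNet

variable {d n : ℕ}

/-! ### Token-wise networks built from feed-forward layers -/

/-- Apply the same map to every token of a sequence. -/
def colwise (F : (Fin d → ℝ) → Fin d → ℝ) (X : Seq d n) : Seq d n :=
  Matrix.of fun i j => F (fun k => X k j) i

theorem IsTransformer.trans {h m r : ℕ} {f g : Seq d n → Seq d n}
    (hf : IsTransformer d n h m r f) (hg : IsTransformer d n h m r g) :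
    IsTransformer d n h m r (f ∘ g) := by
  induction hf with
  | single θ => exact .comp θ g hg
  | comp θ f' _ ih => exact .comp θ _ ih

/-- A map on tokens whose column-wise application is a Transformer network. -/
def IsTokenNet (n : ℕ) (F : (Fin d → ℝ) → Fin d → ℝ) : Prop :=
  IsTransformer d n 2 1 4 (colwise F)

theorem IsTokenNet.comp {F G : (Fin d → ℝ) → Fin d → ℝ}
    (hF : IsTokenNet n F) (hG : IsTokenNet n G) : IsTokenNet n (F ∘ G) :=
  (IsTransformer.trans hF hG : IsTransformer d n 2 1 4 (colwise F ∘ colwise G))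

theorem isTokenNet_feedForward (u v : Fin 4 → Fin d → ℝ) (b : Fin 4 → ℝ) (c : Fin d → ℝ) :
    IsTokenNet n fun x i => x i + ∑ l, v l i * max (∑ k, u l k * x k + b l) 0 + c i := by
  let θ : BlockParams d 2 1 4 :=
    { WO := 0, WV := 0, WK := 0, WQ := 0, W₁ := Matrix.of u
      W₂ := Matrix.of fun i l => v l i, b₁ := b, b₂ := c }
  have : block θ = colwise (n := n)
      fun x i => x i + ∑ l, v l i * max (∑ k, u l k * x k + b l) 0 + c i := by
    funext X
    ext i j
    simp [block, attn, feedForward, colwise, relu, θ, Matrix.mul_apply]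
  unfold IsTokenNet
  rw [← this]
  exact .single θ

/-- A scalar function given by a shallow network with four rectified linear units. -/
def IsShallow (h : ℝ → ℝ) : Prop :=
  ∃ (a u b : Fin 4 → ℝ) (c : ℝ), ∀ t, h t = ∑ l, a l * max (u l * t + b l) 0 + c

theorem isShallow_affine (a c : ℝ) : IsShallow fun t => a * t + c := by
  refine ⟨![a, -a, 0, 0], ![1, -1, 0, 0], 0, c, fun t => ?_⟩
  simp only [Fin.sum_univ_four]
  rcases le_total t 0 with h | h <;> simp [h]

theorem isShallow_relu₃ (a₁ a₂ a₃ b₁ b₂ b₃ : ℝ) :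
    IsShallow fun t => a₁ * max (t - b₁) 0 + a₂ * max (t - b₂) 0 + a₃ * max (t - b₃) 0 := by
  refine ⟨![a₁, a₂, a₃, 0], ![1, 1, 1, 0], ![-b₁, -b₂, -b₃, 0], 0, fun t => ?_⟩
  simp [Fin.sum_univ_four, sub_eq_add_neg]

theorem isShallow_relu (a b : ℝ) : IsShallow fun t => a * max (t - b) 0 := by
  simpa using isShallow_relu₃ a 0 0 b 0 0

theorem isShallow_relu_neg (a : ℝ) : IsShallow fun t => a * max (-t) 0 := by
  refine ⟨![a, 0, 0, 0], ![-1, 0, 0, 0], 0, 0, fun t => ?_⟩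
  simp [Fin.sum_univ_four]

/-- All hidden units read the same functional `w` and write in the same direction `v`, so the hidden
width does not grow with `d`. -/
theorem IsShallow.isTokenNet {h : ℝ → ℝ} (hh : IsShallow h) (w v : Fin d → ℝ) :
    IsTokenNet n fun x i => x i + h (∑ k, w k * x k) * v i := by
  obtain ⟨a, u, b, c, H⟩ := hh
  convert isTokenNet_feedForward (n := n) (fun l k => u l * w k) (fun l i => a l * v i) b
    (fun i => c * v i) using 3 with x i
  rw [H, add_mul, Finset.sum_mul, ← add_assoc]
  congr 2
  refine Finset.sum_congr rfl fun l _ => ?_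
  simp only [mul_assoc, ← Finset.mul_sum]
  ring

theorem IsShallow.isTokenNet_coord {h : ℝ → ℝ} (hh : IsShallow h) (e : Fin d) (v : Fin d → ℝ) :
    IsTokenNet n fun x i => x i + h (x e) * v i := by
  convert hh.isTokenNet (n := n) (Pi.single e 1) v using 5 with x i
  simp [Pi.single_apply]

theorem isTokenNet_id : IsTokenNet n (id : (Fin d → ℝ) → Fin d → ℝ) := by
  have := isTokenNet_feedForward (d := d) (n := n) 0 0 0 0
  simpa using! this

/-- A scalar function that Transformer networks can apply to any single coordinate. -/
def IsScalarNet (d n : ℕ) (h : ℝ → ℝ) : Prop :=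
  ∀ e : Fin d, IsTokenNet n fun x => Function.update x e (h (x e))

theorem IsScalarNet.comp {g h : ℝ → ℝ} (hg : IsScalarNet d n g) (hh : IsScalarNet d n h) :
    IsScalarNet d n (g ∘ h) := fun e => by
  convert (hg e).comp (hh e) using 1
  funext x
  simp

theorem IsShallow.isScalarNet {h : ℝ → ℝ} (hh : IsShallow h) :
    IsScalarNet d n fun t => t + h t := fun e => by
  convert hh.isTokenNet_coord (n := n) e (Pi.single e 1) using 1
  funext x i
  rcases eq_or_ne i e with rfl | hi <;> simp [*]

theorem isScalarNet_affine (a c : ℝ) : IsScalarNet d n fun t => a * t + c := by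
  convert (isShallow_affine (a - 1) c).isScalarNet (d := d) (n := n) using 2
  ring

theorem isTokenNet_pi {h : Fin d → ℝ → ℝ} (hh : ∀ i, IsScalarNet d n (h i)) :
    IsTokenNet n fun x i => h i (x i) := by
  have key (S : Finset (Fin d)) : IsTokenNet n fun x i => if i ∈ S then h i (x i) else x i := by
    induction S using Finset.induction_on with
    | empty => simpa using! isTokenNet_id (d := d) (n := n)
    | insert e S he ih =>
      convert (hh e e).comp ih using 1
      funext x i
      rcases eq_or_ne i e with rfl | hi <;> simp [*]
  simpa using key Finset.univ

/-- Replace a token by a linear functional of it, placed in the coordinate `e`. -/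
theorem isTokenNet_linear (e : Fin d) (w : Fin d → ℝ) :
    IsTokenNet n fun x => Pi.single e (∑ k, w k * x k) := by
  -- Subtracting `Pi.single e 1` cancels the skip connection in coordinate `e`; `h₂` then erases the
  -- other coordinates.
  have h₁ := (isShallow_affine 1 0).isTokenNet (n := n) (w - Pi.single e 1) (Pi.single e 1)
  have h₂ := isTokenNet_pi (d := d) (n := n)
    (h := fun i t => (if i = e then 1 else 0) * t + 0) fun i => isScalarNet_affine _ _
  convert h₂.comp h₁ using 1
  funext x i
  rcases eq_or_ne i e with rfl | hi <;>
    simp [*, sub_mul, Finset.sum_sub_distrib, Pi.single_apply]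

/-! ### Scalar networks: interpolation and quantization -/

/-- Strictly increasing scalar networks interpolate increasing values. -/
theorem exists_strictMono_scalarNet (b : ℕ → ℝ) (hb : StrictMono b) (N : ℕ) :
    ∃ φ : ℝ → ℝ, IsScalarNet d n φ ∧ StrictMono φ ∧ ∀ k ≤ N, φ k = b k := by
  induction N with
  | zero =>
    refine ⟨fun t => 1 * t + b 0, isScalarNet_affine _ _, fun s t h => by simpa using h, ?_⟩
    simp
  | succ N ih =>
    obtain ⟨φ, hφ, hmono, hval⟩ := ih
    have h₁ : b N < φ (N + 1) := by
      rw [← hval N le_rfl]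
      exact hmono (by simp)
    have h₂ : b N < b (N + 1) := hb (Nat.lt_succ_self N)
    -- Slope `1 + a` beyond `b N` carries `φ (N + 1)` to `b (N + 1)` and leaves the earlier values
    -- alone.
    set a : ℝ := (b (N + 1) - b N) / (φ (N + 1) - b N) - 1 with ha
    have ha' : 0 < 1 + a := by
      rw [ha]
      have := div_pos (sub_pos.2 h₂) (sub_pos.2 h₁)
      linarith
    refine ⟨_, ((isShallow_relu a (b N)).isScalarNet).comp hφ, ?_, fun k hk => ?_⟩
    · refine StrictMono.comp (fun s t hst => ?_) hmono
      rcases le_total (s - b N) 0 with hs | hs <;> rcases le_total (t - b N) 0 with ht | ht <;>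
        simp only [max_eq_left, max_eq_right, hs, ht]
      · linarith
      · rcases hs.lt_or_eq with h | h <;> nlinarith
      · nlinarith
      · nlinarith
    · rcases Nat.lt_or_ge N k with h | h
      · obtain rfl : k = N + 1 := by omega
        simp only [Function.comp, Nat.cast_add, Nat.cast_one]
        rw [max_eq_left (by linarith), ha]
        have : φ (N + 1) - b N ≠ 0 := by linarith
        field_simp
        ring
      · simp only [Function.comp, hval k h]
        rw [max_eq_right (sub_nonpos.2 (hb.monotone h))]
        simp

/-- A scalar network that flattens `[k, k + 1 - η]` to `k` for each natural `k < m`. -/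
theorem exists_staircase (m : ℕ) {η : ℝ} (hη : 0 < η) (hη' : η < 1) :
    ∃ q : ℝ → ℝ, IsScalarNet d n q ∧ Monotone q ∧ (∀ k : ℕ, q k = k) ∧
      (∀ t, (m : ℝ) ≤ t → q t = t) ∧
      ∀ (k : ℕ) (t : ℝ), k < m → (k : ℝ) ≤ t → t ≤ k + 1 - η → q t = k := by
  induction m with
  | zero =>
    refine ⟨fun t => 1 * t + 0, isScalarNet_affine _ _, ?_, by simp, by simp, by simp⟩
    intro s t h
    simpa using h
  | succ m ih =>
    obtain ⟨q, hq, hmono, hnat, hlarge, hstep⟩ := ih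
    -- One stair: the slopes are 1, 0, `1 / η`, 1, with breaks at `m`, `m + 1 - η`, `m + 1`.
    let S : ℝ → ℝ := fun t => t + (-1 * max (t - m) 0 + 1 / η * max (t - (m + 1 - η)) 0 +
      (1 - 1 / η) * max (t - (m + 1)) 0)
    have hηi : 1 ≤ 1 / η := by rw [le_div_iff₀ hη]; linarith
    have S₁ (t : ℝ) (ht : t ≤ m) : S t = t := by
      simp only [S]
      rw [max_eq_right (by linarith), max_eq_right (by linarith), max_eq_right (by linarith)]
      simp
    have S₂ (t : ℝ) (ht : m ≤ t) (ht' : t ≤ m + 1 - η) : S t = m := by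
      simp only [S]
      rw [max_eq_left (by linarith), max_eq_right (by linarith), max_eq_right (by linarith)]
      ring
    have S₃ (t : ℝ) (ht : m + 1 - η ≤ t) (ht' : t ≤ m + 1) :
        S t = m + 1 / η * (t - (m + 1 - η)) := by
      simp only [S]
      rw [max_eq_left (by linarith), max_eq_left (by linarith), max_eq_right (by linarith)]
      ring
    have S₄ (t : ℝ) (ht : m + 1 ≤ t) : S t = t := by
      simp only [S]
      rw [max_eq_left (by linarith), max_eq_left (by linarith), max_eq_left (by linarith)]
      field_simp
      ring
    have hS : Monotone S := by
      have m₁ : MonotoneOn S (Set.Iic m) := fun s hs t ht h => by rwa [S₁ s hs, S₁ t ht]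
      have m₂ : MonotoneOn S (Set.Icc m (m + 1 - η)) := fun s hs t ht h => by
        rw [S₂ s hs.1 hs.2, S₂ t ht.1 ht.2]
      have m₃ : MonotoneOn S (Set.Icc (m + 1 - η) (m + 1)) := fun s hs t ht h => by
        rw [S₃ s hs.1 hs.2, S₃ t ht.1 ht.2]
        gcongr
      have m₄ : MonotoneOn S (Set.Ici (m + 1 : ℝ)) := fun s hs t ht h => by rwa [S₄ s hs, S₄ t ht]
      have l₁ : (m : ℝ) ≤ m + 1 - η := by linarith
      have l₂ : (m : ℝ) + 1 - η ≤ m + 1 := by linarith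
      have m₃₄ := m₃.union_right m₄ (isGreatest_Icc l₂) isLeast_Ici
      rw [Set.Icc_union_Ici_eq_Ici l₂] at m₃₄
      have m₂₄ := m₂.union_right m₃₄ (isGreatest_Icc l₁) isLeast_Ici
      rw [Set.Icc_union_Ici_eq_Ici l₁] at m₂₄
      exact m₁.Iic_union_Ici m₂₄
    refine ⟨S ∘ q, ((isShallow_relu₃ _ _ _ _ _ _).isScalarNet).comp hq, hS.comp hmono,
      fun k => ?_, fun t ht => ?_, fun k t hk h₁ h₂ => ?_⟩
    · simp only [Function.comp, hnat]
      rcases Nat.lt_or_ge m k with h | h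
      · exact S₄ _ (by exact_mod_cast h)
      · exact S₁ _ (by exact_mod_cast h)
    · push_cast at ht
      simp only [Function.comp]
      rw [hlarge t (by linarith), S₄ t ht]
    · simp only [Function.comp]
      rcases Nat.lt_succ_iff_lt_or_eq.1 hk with h | rfl
      · rw [hstep k t h h₁ h₂]
        exact S₁ _ (by exact_mod_cast h.le)
      · rw [hlarge t h₁, S₂ t h₁ h₂]

/-- A nonnegative scalar network that flattens `[k, k + 1 - η]` to `k` for each natural `k < m`
and is large outside `(-η, m)`. -/
theorem exists_quantizer (m : ℕ) (R : ℝ) {η : ℝ} (hη : 0 < η) (hη' : η < 1) :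
    ∃ q : ℝ → ℝ, IsScalarNet d n q ∧ (∀ t, 0 ≤ q t) ∧
      (∀ t, t ≤ -η ∨ (m : ℝ) ≤ t → R ≤ q t) ∧
      ∀ (k : ℕ) (t : ℝ), k < m → (k : ℝ) ≤ t → t ≤ k + 1 - η → q t = k := by
  obtain ⟨q, hq, hmono, hnat, hlarge, hstep⟩ := exists_staircase (d := d) (n := n) m hη hη'
  have hq0 : q 0 = 0 := by simpa using hnat 0
  -- `F` folds the negative axis over so that `t ≤ -η` lands beyond `m`; `T` lifts values from `m`
  -- on by at least `|R|` and fixes the stairs, which are at most `m - 1`.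
  let F : ℝ → ℝ := fun t => t + (1 + m / η) * max (-t) 0
  let T : ℝ → ℝ := fun t => t + |R| * max (t - (m - 1)) 0
  have hF₁ (t : ℝ) (ht : 0 ≤ t) : F t = t := by simp [F, ht]
  have hF₂ (t : ℝ) (ht : t ≤ 0) : F t = m / η * (-t) := by simp [F, ht]; ring
  have hF₀ (t : ℝ) : 0 ≤ F t := by
    rcases le_total 0 t with h | h
    · rwa [hF₁ t h]
    · rw [hF₂ t h]
      exact mul_nonneg (by positivity) (by linarith)
  have hT (t : ℝ) : t ≤ T t := by
    have : 0 ≤ |R| * max (t - (m - 1)) 0 := by positivity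
    simp only [T]
    linarith
  have hTm (t : ℝ) (ht : m ≤ t) : R ≤ T t := by
    have h₁ : |R| * 1 ≤ |R| * max (t - (m - 1)) 0 := by
      gcongr
      exact le_max_of_le_left (by linarith)
    have h₂ : (0 : ℝ) ≤ m := Nat.cast_nonneg m
    have h₃ := le_abs_self R
    simp only [T]
    linarith
  have hqF (t : ℝ) : 0 ≤ q (F t) := hq0 ▸ hmono (hF₀ t)
  refine ⟨T ∘ q ∘ F, ((isShallow_relu _ _).isScalarNet).comp
    (hq.comp (isShallow_relu_neg _).isScalarNet), fun t => (hqF t).trans (hT _),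
    fun t ht => hTm _ ?_, fun k t hk h₁ h₂ => ?_⟩
  · have hm : m ≤ F t := by
      rcases ht with h | h
      · rw [hF₂ t (by linarith)]
        calc (m : ℝ) = m / η * η := by field_simp
          _ ≤ m / η * (-t) := by gcongr; linarith
      · rwa [hF₁ t ((Nat.cast_nonneg m).trans h)]
    exact (hnat m).symm.le.trans (hmono hm)
  · have : (k : ℝ) + 1 ≤ m := by exact_mod_cast hk
    simp only [Function.comp]
    rw [hF₁ t ((Nat.cast_nonneg k).trans h₁), hstep k t hk h₁ h₂]
    simp only [T]
    rw [max_eq_right (by linarith)]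
    simp

/-! ### Token-wise interpolation along a coordinate axis -/

theorem exists_lt_forall_mem_le {Z : Finset ℝ} {L a : ℝ} (hL : L < a) (hZ : ∀ z ∈ Z, z < a) :
    ∃ b < a, L ≤ b ∧ ∀ z ∈ Z, z ≤ b := by
  refine ⟨(insert L Z).max' (Finset.insert_nonempty _ _), ?_, ?_, fun z hz => ?_⟩
  · rw [Finset.max'_lt_iff]
    simpa using ⟨hL, hZ⟩
  · exact Finset.le_max' _ _ (Finset.mem_insert_self _ _)
  · exact Finset.le_max' _ _ (Finset.mem_insert_of_mem hz)

/-- Points are peeled off from the largest down: a single ReLU moves the top point to its target and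
fixes everything below it. Targets have coordinate `e` at most `L`, so later layers never disturb
them. -/
theorem exists_tokenNet_interpolate_above (e : Fin d) (L : ℝ) (Z : Finset ℝ)
    (hZ : ∀ z ∈ Z, L < z) (y : ℝ → Fin d → ℝ) (hy : ∀ z ∈ Z, y z e ≤ L) :
    ∃ F : (Fin d → ℝ) → Fin d → ℝ, IsTokenNet n F ∧ Continuous F ∧ (∀ x, x e ≤ L → F x = x) ∧
      ∀ z ∈ Z, F (Pi.single e z) = y z := by
  induction Z using Finset.induction_on_max with
  | empty => exact ⟨id, isTokenNet_id, continuous_id, by simp, by simp⟩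
  | insert a Z ha ih =>
    obtain ⟨F, hF, hcont, hfix, hval⟩ := ih (fun z hz => hZ z (Finset.mem_insert_of_mem hz))
      (fun z hz => hy z (Finset.mem_insert_of_mem hz))
    have haL := hZ a (Finset.mem_insert_self _ _)
    obtain ⟨b, hb, hLb, hZb⟩ := exists_lt_forall_mem_le haL ha
    let G : (Fin d → ℝ) → Fin d → ℝ := fun x i =>
      x i + (1 / (a - b)) * max (x e - b) 0 * (y a - Pi.single e a : Fin d → ℝ) i
    have hG (x : Fin d → ℝ) (hx : x e ≤ b) : G x = x := by
      funext i
      simp [G, hx]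
    have hGa : G (Pi.single e a) = y a := by
      funext i
      have : a - b ≠ 0 := by linarith
      simp only [G, Pi.single_eq_same]
      rw [max_eq_left (by linarith), one_div_mul_cancel this]
      simp
    refine ⟨F ∘ G, hF.comp ((isShallow_relu _ _).isTokenNet_coord e _), hcont.comp ?_,
      fun x hx => ?_, fun z hz => ?_⟩
    · fun_prop
    · rw [Function.comp, hG x (hx.trans hLb), hfix x hx]
    · rw [Function.comp]
      rcases Finset.mem_insert.1 hz with rfl | hz'
      · rw [hGa, hfix _ (hy z (Finset.mem_insert_self _ _))]
      · rw [hG _ (by simpa using hZb z hz'), hval z hz']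

/-- Token-wise networks interpolate arbitrary values on finitely many points of a coordinate half
axis, vanish far out on it, and are bounded on it. -/
theorem exists_tokenNet_interpolate (e : Fin d) (Z : Finset ℝ) {T : ℝ} (hT : 0 ≤ T)
    (hZ : ∀ z ∈ Z, 0 ≤ z ∧ z < T) (y : ℝ → Fin d → ℝ) :
    ∃ F : (Fin d → ℝ) → Fin d → ℝ, IsTokenNet n F ∧
      (∀ z ∈ Z, F (Pi.single e z) = y z) ∧ (∀ t, T ≤ t → F (Pi.single e t) = 0) ∧
      ∃ B, ∀ t, 0 ≤ t → ∀ i, |F (Pi.single e t) i| ≤ B := by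
  obtain ⟨L, hL⟩ : ∃ L : ℝ, 0 ≤ L ∧ ∀ z ∈ Z, y z e ≤ L := by
    refine ⟨∑ z ∈ Z, |y z e|, Finset.sum_nonneg fun _ _ => abs_nonneg _, fun z hz => ?_⟩
    exact (le_abs_self _).trans
      (Finset.single_le_sum (f := fun z => |y z e|) (fun _ _ => abs_nonneg _) hz)
  classical
  obtain ⟨F, hF, hcont, hfix, hval⟩ := exists_tokenNet_interpolate_above (n := n) e L
    (Z.image (· + (L + 1))) (by
      simp only [Finset.mem_image]
      rintro _ ⟨z, hz, rfl⟩
      linarith [(hZ z hz).1]) (fun z => y (z - (L + 1))) (by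
      simp only [Finset.mem_image]
      rintro _ ⟨z, hz, rfl⟩
      simpa using hL.2 z hz)
  obtain ⟨b, hb, hLb, hZb⟩ : ∃ b < T + (L + 1), L ≤ b ∧ ∀ z ∈ Z, z + (L + 1) ≤ b := by
    obtain ⟨b, h₁, h₂, h₃⟩ := exists_lt_forall_mem_le (Z := Z.image (· + (L + 1)))
      (L := L) (a := T + (L + 1)) (by linarith) (by
        simp only [Finset.mem_image]
        rintro _ ⟨z, hz, rfl⟩
        linarith [(hZ z hz).2])
    exact ⟨b, h₁, h₂, fun z hz => h₃ _ (Finset.mem_image_of_mem _ hz)⟩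
  set T' := T + (L + 1) with hT'
  set a : ℝ := T' / (T' - b) with ha
  -- A cutoff: the identity up to `b`, then linear down to 0 at `T'`, then 0. The last ReLU is
  -- padding.
  let c : ℝ → ℝ := fun t => t + (-a * max (t - b) 0 + (a - 1) * max (t - T') 0 +
    0 * max (t - 0) 0)
  have hc₁ (t : ℝ) (ht : t ≤ b) : c t = t := by
    simp only [c]
    rw [max_eq_right (by linarith), max_eq_right (by linarith)]
    ring
  have hc₂ (t : ℝ) (ht : T' ≤ t) : c t = 0 := by
    have : T' - b ≠ 0 := by linarith
    simp only [c]
    rw [max_eq_left (by linarith), max_eq_left (by linarith), ha]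
    field_simp
    ring
  have hsc : IsScalarNet d n (c ∘ fun t => 1 * t + (L + 1)) :=
    (isShallow_relu₃ _ _ _ _ _ _).isScalarNet.comp (isScalarNet_affine _ _)
  have hnet := hF.comp (hsc e)
  have hupd (t : ℝ) : (F ∘ fun x => Function.update x e ((c ∘ fun t => 1 * t + (L + 1)) (x e)))
      (Pi.single e t) = F (Pi.single e (c (t + (L + 1)))) := by
    simp [Function.comp, Pi.single, Function.update_idem]
  have hzero (t : ℝ) (ht : T ≤ t) : F (Pi.single e (c (t + (L + 1)))) = 0 := by
    rw [hc₂ _ (by linarith), hfix _ (by simpa using hL.1)]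
    simp
  refine ⟨_, hnet, fun z hz => ?_, fun t ht => ?_, ?_⟩
  · rw [hupd, hc₁ _ (hZb z hz), hval _ (Finset.mem_image_of_mem _ hz)]
    simp
  · rw [hupd, hzero t ht]
  · have hcc : Continuous fun t => F (Pi.single e (c (t + (L + 1)))) := by
      refine hcont.comp ((continuous_single e).comp ?_)
      simp only [c]
      fun_prop
    obtain ⟨B, hB⟩ := (isCompact_Icc (a := (0 : ℝ)) (b := T)).exists_bound_of_continuousOn
      hcc.continuousOn
    refine ⟨max B 0, fun t ht i => ?_⟩
    rw [hupd]
    rcases le_total t (T) with h | h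
    · exact ((norm_le_pi_norm _ i).trans (hB t ⟨ht, h⟩)).trans (le_max_left _ _)
    · rw [hzero t h]
      simp

/-! ### Uniform attention and the context code -/

/-- The attention layer with constant weights adds a multiple of the sum of one coordinate. -/
theorem isTransformer_add_sum (hn : 0 < n) (e : Fin d) (γ : ℝ) :
    IsTransformer d n 2 1 4 fun X =>
      X + Matrix.of fun i _ => if i = e then γ * ∑ k, X e k else 0 := by
  let θ : BlockParams d 2 1 4 :=
    -- Zero keys and queries make every softmax weight `1 / n`; the factor `n` undoes the averaging.
    { WO := ![Matrix.of fun i _ => if i = e then γ * n else 0, 0]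
      WV := ![Matrix.of fun _ i => if i = e then 1 else 0, 0]
      WK := 0, WQ := 0, W₁ := 0, W₂ := 0, b₁ := 0, b₂ := 0 }
  have : block θ = fun X : Seq d n =>
      X + Matrix.of fun i _ => if i = e then γ * ∑ k, X e k else 0 := by
    funext X
    ext i j
    have hn' : (n : ℝ) ≠ 0 := by positivity
    simp [block, attn, feedForward, softmax, θ, Matrix.mul_apply]
    split_ifs
    · rw [← Finset.sum_mul, ← Finset.mul_sum]
      field_simp
    · simp
  rw [← this]
  exact .single θ

/-- Each value occurs at most `n` times, so the multiplicities are the base `n + 1` digits of the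
sum. -/
theorem exists_perm_of_sum_pow_eq {N : ℕ} {a a' : Fin n → Fin N}
    (h : ∑ j, (n + 1) ^ (a j : ℕ) = ∑ j, (n + 1) ^ (a' j : ℕ)) :
    ∃ σ : Equiv.Perm (Fin n), a' = a ∘ σ := by
  classical
  let c (b : Fin n → Fin N) (v : Fin N) : Fin (n + 1) :=
    ⟨(Finset.univ.filter fun j => b j = v).card,
      Nat.lt_succ_of_le ((Finset.card_le_univ _).trans (Fintype.card_fin n).le)⟩
  have hc (b : Fin n → Fin N) : ∑ j, (n + 1) ^ (b j : ℕ) = (finFunctionFinEquiv (c b) : ℕ) := by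
    rw [finFunctionFinEquiv_apply, ← Finset.sum_fiberwise Finset.univ b]
    refine Finset.sum_congr rfl fun v _ => ?_
    rw [Finset.sum_congr rfl (g := fun _ => (n + 1) ^ (v : ℕ)), Finset.sum_const, smul_eq_mul]
    simp +contextual
  rw [hc, hc] at h
  have hcc := finFunctionFinEquiv.injective (Fin.ext h)
  have e (v : Fin N) : Nonempty ({j // a' j = v} ≃ {j // a j = v}) := by
    refine Fintype.card_eq.1 ?_
    rw [Fintype.card_subtype, Fintype.card_subtype]
    exact (Fin.mk.inj (congrFun hcc v)).symm
  exact ⟨Equiv.ofFiberEquiv fun v => (e v).some,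
    funext fun j => (Equiv.ofFiberEquiv_map (fun v => (e v).some) j).symm⟩

/-- A number that determines the entry at `j` and the multiset of entries of a tuple. -/
def contextCode {N : ℕ} (a : Fin n → Fin N) (j : Fin n) : ℕ :=
  (n + 1) ^ (a j : ℕ) + (n + 1) ^ N * ∑ k, (n + 1) ^ (a k : ℕ)

theorem contextCode_lt (hn : 0 < n) {N : ℕ} (a : Fin n → Fin N) (j : Fin n) :
    contextCode a j < (n + 1) ^ N * (n + 1) ^ N := by
  have h₁ : (n + 1) ^ (a j : ℕ) < (n + 1) ^ N := Nat.pow_lt_pow_right (by omega) (a j).2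
  have h₂ : ∑ k, (n + 1) ^ (a k : ℕ) < (n + 1) ^ N := by
    have : ∑ k, (n + 1) ^ (a k : ℕ) * (n + 1) ≤ ∑ _k : Fin n, (n + 1) ^ N :=
      Finset.sum_le_sum fun k _ => by
        rw [← pow_succ]
        exact Nat.pow_le_pow_right (by omega) (a k).2
    rw [← Finset.sum_mul, Finset.sum_const, Finset.card_univ, Fintype.card_fin, smul_eq_mul] at this
    have h₃ : 0 < (n + 1) ^ N := by positivity
    nlinarith
  unfold contextCode
  nlinarith [Nat.mul_le_mul_left ((n + 1) ^ N) (Nat.succ_le_of_lt h₂)]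

/-- Reduction mod `(n + 1) ^ N` recovers the entry, the quotient the multiset. A swap of two
positions with equal entries then arranges `σ j' = j`. -/
theorem exists_perm_of_contextCode_eq (hn : 0 < n) {N : ℕ} {a a' : Fin n → Fin N} {j j' : Fin n}
    (h : contextCode a j = contextCode a' j') :
    ∃ σ : Equiv.Perm (Fin n), a' = a ∘ σ ∧ σ j' = j := by
  have hlt (b : Fin n → Fin N) (i : Fin n) : (n + 1) ^ (b i : ℕ) < (n + 1) ^ N :=
    Nat.pow_lt_pow_right (by omega) (b i).2
  unfold contextCode at h
  have h₁ : (n + 1) ^ (a j : ℕ) = (n + 1) ^ (a' j' : ℕ) := by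
    have := congrArg (· % (n + 1) ^ N) h
    simpa [Nat.add_mul_mod_self_left, Nat.mod_eq_of_lt, hlt] using this
  have hj : a j = a' j' := Fin.ext (Nat.pow_right_injective (by omega) h₁)
  rw [h₁] at h
  obtain ⟨σ, hσ⟩ := exists_perm_of_sum_pow_eq
    (Nat.eq_of_mul_eq_mul_left (by positivity) (Nat.add_left_cancel h))
  refine ⟨σ.trans (Equiv.swap j (σ j')), ?_, by simp⟩
  funext k
  have : a (σ j') = a j := by rw [hj, hσ]; rfl
  simp only [hσ, Function.comp, Equiv.trans_apply]
  rw [Equiv.swap_apply_def]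
  split_ifs with h₂ h₃
  · rw [h₂, this]
  · rw [h₃, this]
  · rfl

theorem isTokenNet_encode (e : Fin d) (w : Fin d → ℝ) {φ q : ℝ → ℝ} (hφ : IsScalarNet d n φ)
    (hq : IsScalarNet d n q) :
    IsTokenNet n fun x => Pi.single e (φ (∑ i, w i * q (x i))) := by
  convert (hφ e).comp ((isTokenNet_linear e w).comp (isTokenNet_pi fun _ => hq)) using 1
  funext x
  simp [Function.comp, Pi.single, Function.update_idem]

/-! ### Assembling the network -/

/-- Transformer networks realize any permutation equivariant assignment of outputs to grid cells,
up to strips of width `η`, vanish outside the grid, and are bounded uniformly in `η`. -/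
theorem exists_transformer_of_cells (hn : 0 < n) (e : Fin d) {m : ℕ} (hm : 0 < m)
    (G : (Fin n → Fin d → Fin m) → Fin n → Fin d → ℝ)
    (hG : ∀ K (σ : Equiv.Perm (Fin n)), G (K ∘ σ) = G K ∘ σ) :
    ∃ B, ∀ η : ℝ, 0 < η → η < 1 → ∃ g : Seq d n → Seq d n, IsTransformer d n 2 1 4 g ∧
      (∀ X i j, |g X i j| ≤ B) ∧
      (∀ X K, (∀ i j, ((K j i : ℕ) : ℝ) ≤ X i j ∧ X i j ≤ (K j i : ℕ) + 1 - η) →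
        ∀ i j, g X i j = G K j i) ∧
      ∀ X, (∃ i j, X i j ≤ -η ∨ (m : ℝ) ≤ X i j) → g X = 0 := by
  classical
  set N := m ^ d with hN
  let cell (K : Fin n → Fin d → Fin m) : Fin n → Fin N := fun j => finFunctionFinEquiv (K j)
  let code (p : (Fin n → Fin d → Fin m) × Fin n) : ℝ := contextCode (cell p.1) p.2
  have hfac : Function.FactorsThrough (fun p : (Fin n → Fin d → Fin m) × Fin n => G p.1 p.2)
      code := by
    rintro ⟨K, j⟩ ⟨K', j'⟩ h
    obtain ⟨σ, hσ, hj⟩ := exists_perm_of_contextCode_eq hn (Nat.cast_injective h)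
    have : K' = K ∘ σ := funext fun k => finFunctionFinEquiv.injective (congrFun hσ k)
    simp [this, hG, hj]
  set γ : ℝ := (n + 1) ^ N with hγ
  have hγ0 : 0 ≤ γ := by positivity
  -- `Ψ` and `B` are chosen before `η`, which makes the bound uniform.
  obtain ⟨Ψ, hΨ, hval, hzero, B, hB⟩ := exists_tokenNet_interpolate (n := n) e
    (Finset.univ.image code) (T := γ * γ) (by positivity) (by
      simp only [Finset.mem_image, Finset.mem_univ, true_and]
      rintro _ ⟨p, rfl⟩
      exact ⟨Nat.cast_nonneg _, by
        simp only [code, hγ]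
        exact_mod_cast contextCode_lt hn (cell p.1) p.2⟩)
    (Function.extend code (fun p => G p.1 p.2) 0)
  obtain ⟨φ, hφ, hmono, hpow⟩ := exists_strictMono_scalarNet (d := d) (n := n)
    (fun k => ((n : ℝ) + 1) ^ k) (pow_right_strictMono₀ (by simpa using hn)) N
  refine ⟨B, fun η hη hη' => ?_⟩
  -- With threshold `N`, one stray coordinate forces `s ≥ N` for its token; the attention sum then
  -- pushes every token's code past `γ * γ`, where `Ψ` vanishes.
  obtain ⟨q, hq, hq0, hqout, hqcell⟩ := exists_quantizer (d := d) (n := n) m N hη hη'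
  let s (X : Seq d n) (j : Fin n) : ℝ := ∑ i : Fin d, (m : ℝ) ^ (i : ℕ) * q (X i j)
  have hs (X : Seq d n) (j : Fin n) : 0 ≤ s X j :=
    Finset.sum_nonneg fun i _ => mul_nonneg (by positivity) (hq0 _)
  have hφs (X : Seq d n) (j : Fin n) : 0 ≤ φ (s X j) := by
    have h0 : φ 0 = 1 := by simpa using hpow 0 (Nat.zero_le _)
    linarith [hmono.monotone (hs X j)]
  let t (X : Seq d n) (j : Fin n) : ℝ := φ (s X j) + γ * ∑ k, φ (s X k)
  have ht (X : Seq d n) (j : Fin n) : 0 ≤ t X j :=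
    add_nonneg (hφs X j) (mul_nonneg hγ0 (Finset.sum_nonneg fun k _ => hφs X k))
  have hnet : IsTransformer d n 2 1 4
      fun X => Matrix.of fun i j => Ψ (Pi.single e (t X j)) i := by
    convert IsTransformer.trans hΨ ((isTransformer_add_sum hn e γ).trans
      (isTokenNet_encode e (fun i => (m : ℝ) ^ (i : ℕ)) hφ hq)) using 1
    funext X
    ext i j
    simp only [Function.comp, colwise, Matrix.of_apply, Matrix.add_apply]
    congr 1
    funext k
    rcases eq_or_ne k e with rfl | hk <;> simp [*, t, s]
  refine ⟨_, hnet, fun X i j => hB _ (ht X j) i, fun X K hK i j => ?_, fun X hX => ?_⟩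
  · have hsK (k : Fin n) : φ (s X k) = ((n : ℝ) + 1) ^ (cell K k : ℕ) := by
      have : s X k = (cell K k : ℕ) := by
        simp only [s, cell, finFunctionFinEquiv_apply]
        push_cast
        refine Finset.sum_congr rfl fun i _ => ?_
        rw [hqcell _ _ (K k i).2 (hK i k).1 (hK i k).2, mul_comm]
      rw [this, hpow _ (cell K k).2.le]
    have htK : t X j = code (K, j) := by
      simp [t, code, hsK, contextCode, hγ]
    rw [Matrix.of_apply, htK, hval _ (Finset.mem_image_of_mem _ (Finset.mem_univ _)),
      hfac.extend_apply]
  · obtain ⟨i₀, j₀, hX⟩ := hX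
    have h₁ : (N : ℝ) ≤ s X j₀ := by
      have hm' : (1 : ℝ) ≤ (m : ℝ) ^ (i₀ : ℕ) := one_le_pow₀ (by exact_mod_cast hm)
      calc (N : ℝ) ≤ q (X i₀ j₀) := hqout _ hX
        _ ≤ (m : ℝ) ^ (i₀ : ℕ) * q (X i₀ j₀) := le_mul_of_one_le_left (hq0 _) hm'
        _ ≤ s X j₀ := Finset.single_le_sum (f := fun i : Fin d => (m : ℝ) ^ (i : ℕ) * q (X i j₀))
          (fun i _ => mul_nonneg (by positivity) (hq0 _)) (Finset.mem_univ i₀)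
    have h₂ : γ ≤ ∑ k, φ (s X k) :=
      calc γ = φ N := (hpow N le_rfl).symm
        _ ≤ φ (s X j₀) := hmono.monotone h₁
        _ ≤ _ := Finset.single_le_sum (f := fun k => φ (s X k)) (fun k _ => hφs X k)
          (Finset.mem_univ j₀)
    ext i j
    have h₃ : γ * γ ≤ t X j :=
      (mul_le_mul_of_nonneg_left h₂ hγ0).trans (le_add_of_nonneg_left (hφs X j))
    simp [hzero _ h₃]

/-! ### Error estimates and the exceptional strips -/

theorem PermEquivariant.apply_perm {f : Seq d n → Seq d n} (hf : PermEquivariant f)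
    (σ : Equiv.Perm (Fin n)) (X : Seq d n) :
    f (X.submatrix id σ) = (f X).submatrix id σ := by
  have := hf σ.symm X
  simpa [Equiv.Perm.permMatrix, PEquiv.mul_toMatrix_toPEquiv] using this

theorem entryNorm_rpow_le {p c : ℝ} (hp : 1 ≤ p) {A : Seq d n} (hA : ∀ i j, |A i j| ≤ c) :
    entryNorm p A ^ p ≤ d * n * c ^ p := by
  have hp0 : 0 < p := by linarith
  unfold entryNorm
  rw [← Real.rpow_mul (Finset.sum_nonneg fun i _ => Finset.sum_nonneg fun j _ => by positivity),
    one_div_mul_cancel hp0.ne', Real.rpow_one]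
  calc ∑ i, ∑ j, |A i j| ^ p ≤ ∑ _i : Fin d, ∑ _j : Fin n, c ^ p := by
        gcongr with i _ j _
        exact hA i j
    _ = d * n * c ^ p := by simp [mul_assoc]

theorem lpDist_le_of_bounds {p ε : ℝ} (hp : 1 ≤ p) (hε : 0 < ε) {f g : Seq d n → Seq d n}
    {box bad : Set (Fin d → Fin n → ℝ)} (hbox : MeasurableSet box) (hbad : MeasurableSet bad)
    {c C : ℝ} (hzero : ∀ x ∉ box, f x = g x)
    (hgood : ∀ x, x ∉ bad → ∀ i j, |f x i j - g x i j| ≤ c)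
    (hC : ∀ x i j, |f x i j - g x i j| ≤ C)
    (h₁ : ENNReal.ofReal (d * n * c ^ p) * volume box ≤ ENNReal.ofReal (ε ^ p / 2))
    (h₂ : ENNReal.ofReal (d * n * C ^ p) * volume bad ≤ ENNReal.ofReal (ε ^ p / 2)) :
    lpDist p f g ≤ ENNReal.ofReal ε := by
  have hp0 : 0 < p := by linarith
  have hεp : 0 < ε ^ p := Real.rpow_pos_of_pos hε p
  have hpoint (x : Fin d → Fin n → ℝ) :
      ENNReal.ofReal (entryNorm p (f (Matrix.of x) - g (Matrix.of x)) ^ p) ≤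
        box.indicator (fun _ => ENNReal.ofReal (d * n * c ^ p)) x +
          bad.indicator (fun _ => ENNReal.ofReal (d * n * C ^ p)) x := by
    by_cases hb : x ∈ bad
    · rw [Set.indicator_of_mem hb]
      exact le_add_of_nonneg_of_le zero_le
        (ENNReal.ofReal_le_ofReal (entryNorm_rpow_le hp (hC x)))
    · rw [Set.indicator_of_notMem hb, add_zero]
      by_cases hx : x ∈ box
      · rw [Set.indicator_of_mem hx]
        exact ENNReal.ofReal_le_ofReal (entryNorm_rpow_le hp (hgood x hb))
      · have : f (Matrix.of x) - g (Matrix.of x) = 0 := sub_eq_zero.2 (hzero x hx)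
        rw [this]
        have h0 := entryNorm_rpow_le (d := d) (n := n) hp (A := 0) (c := 0) (by simp)
        rw [Real.zero_rpow hp0.ne', mul_zero] at h0
        rw [ENNReal.ofReal_of_nonpos h0]
        exact zero_le
  have hI : ∫⁻ x : Fin d → Fin n → ℝ,
      ENNReal.ofReal (entryNorm p (f (Matrix.of x) - g (Matrix.of x)) ^ p) ≤
        ENNReal.ofReal (ε ^ p) := by
    refine (lintegral_mono hpoint).trans ?_
    rw [lintegral_add_left (measurable_const.indicator hbox), lintegral_indicator_const hbox,
      lintegral_indicator_const hbad]
    refine (add_le_add h₁ h₂).trans ?_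
    rw [← ENNReal.ofReal_add (by positivity) (by positivity), add_halves]
  unfold lpDist
  refine (ENNReal.rpow_le_rpow hI (by positivity)).trans ?_
  rw [ENNReal.ofReal_rpow_of_nonneg hεp.le (by positivity), ← Real.rpow_mul hε.le,
    mul_one_div_cancel hp0.ne', Real.rpow_one]

/-- The sequences in the grid region whose coordinates do not all lie in shrunken cells, where
`a` is the coordinate-wise rescaling to the unit grid with `m` cells. -/
def badSet (a : ℝ → ℝ) (m : ℕ) (η : ℝ) : Set (Fin d → Fin n → ℝ) :=
  {x | (∀ i j, -η < a (x i j) ∧ a (x i j) < m) ∧ ¬ ∃ K : Fin n → Fin d → Fin m,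
    ∀ i j, ((K j i : ℕ) : ℝ) ≤ a (x i j) ∧ a (x i j) ≤ (K j i : ℕ) + 1 - η}

theorem measurableSet_badSet {a : ℝ → ℝ} (ha : Continuous a) (m : ℕ) (η : ℝ) :
    MeasurableSet (badSet a m η : Set (Fin d → Fin n → ℝ)) := by
  have hm (i : Fin d) (j : Fin n) : Measurable fun x : Fin d → Fin n → ℝ => a (x i j) :=
    (ha.comp (by fun_prop)).measurable
  refine measurableSet_setOfPred.2 (.and (.forall fun i => .forall fun j => ?_)
    (.not (.exists fun K => .forall fun i => .forall fun j => ?_)))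
  · exact (measurableSet_setOfPred.1 (measurableSet_lt measurable_const (hm i j))).and
      (measurableSet_setOfPred.1 (measurableSet_lt (hm i j) measurable_const))
  · exact (measurableSet_setOfPred.1 (measurableSet_le measurable_const (hm i j))).and
      (measurableSet_setOfPred.1 (measurableSet_le (hm i j) measurable_const))

theorem badSet_mono (a : ℝ → ℝ) (m : ℕ) :
    Monotone fun η => (badSet a m η : Set (Fin d → Fin n → ℝ)) := by
  rintro η η' h x ⟨h₁, h₂⟩
  refine ⟨fun i j => ⟨by linarith [(h₁ i j).1], (h₁ i j).2⟩, fun ⟨K, hK⟩ => h₂ ⟨K, fun i j =>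
    ⟨(hK i j).1, by linarith [(hK i j).2]⟩⟩⟩

/-- A point bad for all `η l` would have nonnegative rescaled coordinates; their floors give a cell,
and since `t < ⌊t⌋₊ + 1` strictly, small `η l` fits. -/
theorem exists_notMem_badSet (a : ℝ → ℝ) (m : ℕ) {η : ℕ → ℝ}
    (hη : Filter.Tendsto η Filter.atTop (nhds 0)) (x : Fin d → Fin n → ℝ) :
    ∃ l, x ∉ badSet a m (η l) := by
  by_contra! hx
  have h0 (i : Fin d) (j : Fin n) : 0 ≤ a (x i j) := by
    have : Filter.Tendsto (fun l => -η l) Filter.atTop (nhds 0) := by simpa using hη.neg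
    exact le_of_tendsto this (.of_forall fun l => ((hx l).1 i j).1.le)
  let K (j : Fin n) (i : Fin d) : Fin m :=
    ⟨⌊a (x i j)⌋₊, (Nat.floor_lt (h0 i j)).2 ((hx 0).1 i j).2⟩
  have hK : ∀ᶠ l in Filter.atTop, ∀ i j, a (x i j) ≤ (K j i : ℕ) + 1 - η l := by
    refine Filter.eventually_all.2 fun i => Filter.eventually_all.2 fun j => ?_
    have : 0 < (K j i : ℕ) + 1 - a (x i j) := sub_pos.2 (Nat.lt_floor_add_one _)
    filter_upwards [hη.eventually_lt_const this] with l hl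
    linarith
  obtain ⟨l, hl⟩ := hK.exists
  exact (hx l).2 ⟨K, fun i j => ⟨Nat.floor_le (h0 i j), hl i j⟩⟩

/-- Continuity of the measure from above along decreasing sets with empty intersection replaces an
explicit volume count. -/
theorem exists_volume_badSet_le {a : ℝ → ℝ} (ha : Continuous a) (m : ℕ)
    {box : Set (Fin d → Fin n → ℝ)} (hbox : volume box ≠ ⊤)
    (hsub : ∀ η < 1, badSet a m η ⊆ box) (C : ENNReal) (hC : C ≠ ⊤) {δ : ENNReal} (hδ : 0 < δ) :
    ∃ η : ℝ, 0 < η ∧ η < 1 ∧ C * volume (badSet a m η : Set (Fin d → Fin n → ℝ)) ≤ δ := by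
  let η : ℕ → ℝ := fun l => 1 / ((l + 1 : ℕ) + 1 : ℝ)
  have hη : Filter.Tendsto η Filter.atTop (nhds 0) :=
    (tendsto_one_div_add_atTop_nhds_zero_nat (𝕜 := ℝ)).comp (Filter.tendsto_add_atTop_nat 1)
  have hη₀ (l : ℕ) : 0 < η l := by positivity
  have hη₁ (l : ℕ) : η l < 1 := by
    simp only [η]
    rw [div_lt_one (by positivity)]
    push_cast
    linarith [(Nat.cast_nonneg l : (0 : ℝ) ≤ l)]
  have hanti : Antitone η := fun l l' h => by
    simp only [η]
    gcongr
  have hlim := tendsto_measure_iInter_atTop (μ := volume)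
    (s := fun l => (badSet a m (η l) : Set (Fin d → Fin n → ℝ)))
    (fun l => (measurableSet_badSet ha m _).nullMeasurableSet)
    ((badSet_mono a m).comp_antitone hanti)
    ⟨0, ne_top_of_le_ne_top hbox (measure_mono (hsub _ (hη₁ 0)))⟩
  have hempty : ⋂ l, (badSet a m (η l) : Set (Fin d → Fin n → ℝ)) = ∅ := by
    refine Set.eq_empty_of_forall_notMem fun x hx => ?_
    obtain ⟨l, hl⟩ := exists_notMem_badSet a m hη x
    exact hl (Set.mem_iInter.1 hx l)
  rw [hempty, measure_empty] at hlim
  have hlim' := ENNReal.Tendsto.const_mul hlim (Or.inr hC)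
  rw [mul_zero] at hlim'
  obtain ⟨l, hl⟩ := (hlim'.eventually_lt_const hδ).exists
  exact ⟨η l, hη₀ l, hη₁ l, hl.le⟩

/-! ### Consequences of compact support, and the theorem -/

theorem exists_forall_eq_zero_of_hasCompactSupport {f : Seq d n → Seq d n}
    (hf : HasCompactSupport f) :
    ∃ M : ℝ, 0 < M ∧ ∀ X, (∃ i j, M ≤ |X i j|) → f X = 0 := by
  let F : (Fin d → Fin n → ℝ) → Fin d → Fin n → ℝ := f
  obtain ⟨M, hM, hb⟩ := (show IsCompact (tsupport F) from hf).isBounded.exists_pos_norm_lt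
  refine ⟨M, hM, fun X ⟨i, j, hX⟩ => ?_⟩
  by_contra hne
  have h₁ := hb X (subset_tsupport F hne)
  have h₂ := (norm_le_pi_norm (show Fin d → Fin n → ℝ from X) i).trans' (norm_le_pi_norm (X i) j)
  rw [Real.norm_eq_abs] at h₂
  exact absurd (h₂.trans_lt h₁) (not_lt.2 hX)

theorem exists_bound_of_hasCompactSupport {f : Seq d n → Seq d n} (hf : Continuous f)
    (hf' : HasCompactSupport f) : ∃ C : ℝ, ∀ X i j, |f X i j| ≤ C := by
  let F : (Fin d → Fin n → ℝ) → Fin d → Fin n → ℝ := f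
  have hF : Continuous F := hf
  obtain ⟨C, hC⟩ := hF.bounded_above_of_compact_support hf'
  exact ⟨C, fun X i j => ((norm_le_pi_norm (F X) i).trans' (norm_le_pi_norm (F X i) j)).trans
    (hC X)⟩

theorem exists_delta_of_hasCompactSupport {f : Seq d n → Seq d n} (hf : Continuous f)
    (hf' : HasCompactSupport f) {c : ℝ} (hc : 0 < c) :
    ∃ δ : ℝ, 0 < δ ∧ ∀ X Y, (∀ i j, |X i j - Y i j| ≤ δ) → ∀ i j, |f X i j - f Y i j| ≤ c := by
  let F : (Fin d → Fin n → ℝ) → Fin d → Fin n → ℝ := f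
  have hF : UniformContinuous F := HasCompactSupport.uniformContinuous_of_continuous hf' hf
  obtain ⟨δ, hδ, h⟩ := Metric.uniformContinuous_iff_le.1 hF c hc
  refine ⟨δ, hδ, fun X Y hXY i j => ?_⟩
  have h₁ : dist (show Fin d → Fin n → ℝ from X) Y ≤ δ :=
    (dist_pi_le_iff hδ.le).2 fun i => (dist_pi_le_iff hδ.le).2 fun j => hXY i j
  exact (dist_pi_le_iff hc.le).1 ((dist_pi_le_iff hc.le).1 (h h₁) i) j

end TransformerNet

open TransformerNet in
theorem theorem1 (d n : ℕ) (hn : 2 ≤ n) (p : ℝ) (hp : 1 ≤ p) (ε : ℝ) (hε : 0 < ε)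
    (f : TransformerNet.Seq d n → TransformerNet.Seq d n) (hf_cont : Continuous f)
    (hf_supp : HasCompactSupport f) (hf_perm : TransformerNet.PermEquivariant f) :
    ∃ g : TransformerNet.Seq d n → TransformerNet.Seq d n,
      TransformerNet.IsTransformer d n 2 1 4 g ∧
        TransformerNet.lpDist p f g ≤ ENNReal.ofReal ε := by
  rcases Nat.eq_zero_or_pos d with rfl | hd
  · refine ⟨_, isTokenNet_id, ?_⟩
    have : f = colwise id := funext fun X => Matrix.ext fun i => i.elim0
    have hp0 : p ≠ 0 := by linarith
    have hp0' : 0 < p := by linarith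
    simp [lpDist, entryNorm, hp0, hp0']
  have hεp : 0 < ε ^ p := Real.rpow_pos_of_pos hε p
  have hp0 : 0 < p := by linarith
  obtain ⟨M, hM, hfM⟩ := exists_forall_eq_zero_of_hasCompactSupport hf_supp
  obtain ⟨C, hfC⟩ := exists_bound_of_hasCompactSupport hf_cont hf_supp
  -- Large enough for all `η < 1`: `a t > -1 > -m` below gives `t > -3 * M`.
  let box : Set (Fin d → Fin n → ℝ) := Set.Icc (fun _ _ => -3 * M) (fun _ _ => M)
  have hbox : volume box ≠ ⊤ := isCompact_Icc.measure_lt_top.ne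
  set V : ℝ := (volume box).toReal with hV
  have hV0 : 0 ≤ V := ENNReal.toReal_nonneg
  -- Makes `d * n * c ^ p * V` at most `ε ^ p / 2`; the `+ 1` keeps the denominator positive.
  set c : ℝ := (ε ^ p / (2 * (d * n * V + 1))) ^ (1 / p) with hcdef
  have hc : 0 < c := by positivity
  have hcp : c ^ p = ε ^ p / (2 * (d * n * V + 1)) := by
    rw [hcdef, ← Real.rpow_mul (by positivity), one_div_mul_cancel hp0.ne', Real.rpow_one]
  obtain ⟨δ, hδ, hfδ⟩ := exists_delta_of_hasCompactSupport hf_cont hf_supp hc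
  obtain ⟨m, hm⟩ := exists_nat_gt (max 1 (2 * M / δ))
  have hm1 : (1 : ℝ) < m := (le_max_left _ _).trans_lt hm
  have hm0 : (0 : ℝ) < m := by linarith
  have hmδ : 2 * M / m ≤ δ := by
    rw [div_le_comm₀ hm0 hδ]
    exact ((le_max_right _ _).trans_lt hm).le
  let κ : ℝ := m / (2 * M)
  have hκ : 0 < κ := by positivity
  have hκM : κ * (2 * M) = m := by simp only [κ]; field_simp
  have hκδ : 1 / κ ≤ δ := by simpa [κ] using hmδ
  let a : ℝ → ℝ := fun t => κ * t + κ * M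
  have ha : Continuous a := by fun_prop
  -- This is the lower corner of the cell, within `1 / κ ≤ δ` of its points in each entry.
  let center (K : Fin n → Fin d → Fin m) : Seq d n := Matrix.of fun i j => (K j i : ℕ) / κ - M
  obtain ⟨B, hB⟩ := exists_transformer_of_cells (n := n) (by omega) (⟨0, hd⟩ : Fin d)
    (by exact_mod_cast hm0 : 0 < m) (fun K j i => f (center K) i j) (fun K σ => by
      have : center (K ∘ σ) = (center K).submatrix id σ := rfl
      funext j i
      rw [this, hf_perm.apply_perm]
      rfl)
  have hinbox (η : ℝ) (hη : η < 1) (x : Fin d → Fin n → ℝ)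
      (hx : ∀ i j, -η < a (x i j) ∧ a (x i j) < m) : x ∈ box := by
    refine ⟨fun i j => ?_, fun i j => ?_⟩
    · have := (hx i j).1
      simp only [a] at this
      by_contra! h
      have h' : κ * (x i j + M) < κ * (-(2 * M)) := mul_lt_mul_of_pos_left (by linarith) hκ
      linarith
    · have := (hx i j).2
      simp only [a] at this
      by_contra! h
      have h' : κ * (2 * M) < κ * (x i j + M) := mul_lt_mul_of_pos_left (by linarith) hκ
      linarith
  obtain ⟨η, hη, hη', hbad⟩ := exists_volume_badSet_le ha m hbox
    (fun η hη x hx => hinbox η hη x hx.1) (ENNReal.ofReal (d * n * (C + B) ^ p))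
    ENNReal.ofReal_ne_top (δ := ENNReal.ofReal (ε ^ p / 2)) (by simpa using hεp)
  obtain ⟨g, hg, hgB, hgK, hg0⟩ := hB η hη hη'
  have hscale : IsTokenNet n fun (x : Fin d → ℝ) i => a (x i) :=
    isTokenNet_pi fun _ => isScalarNet_affine _ _
  have hout (x : Seq d n) (hx : ¬ ∀ i j, -η < a (x i j) ∧ a (x i j) < m) :
      f x = 0 ∧ (g ∘ colwise fun x i => a (x i)) x = 0 := by
    simp only [not_forall, not_and_or, not_lt] at hx
    refine ⟨hfM x ?_, hg0 _ hx⟩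
    obtain ⟨i, j, h | h⟩ := hx
    · refine ⟨i, j, le_abs.2 (Or.inr ?_)⟩
      simp only [a] at h
      by_contra! h'
      nlinarith
    · refine ⟨i, j, le_abs.2 (Or.inl ?_)⟩
      simp only [a] at h
      by_contra! h'
      nlinarith
  refine ⟨_, hg.trans hscale, lpDist_le_of_bounds hp hε (box := box) (bad := badSet a m η)
    measurableSet_Icc (measurableSet_badSet ha m η) (c := c) (C := C + B) (fun x hx => ?_)
    (fun x hx i j => ?_) (fun x i j => ?_) ?_ hbad⟩
  · obtain ⟨h₁, h₂⟩ := hout x fun h => hx (hinbox η hη' x h)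
    rw [h₁, h₂]
  · by_cases hx' : ∀ i j, -η < a (x i j) ∧ a (x i j) < m
    · obtain ⟨K, hK⟩ : ∃ K : Fin n → Fin d → Fin m, ∀ i j,
          ((K j i : ℕ) : ℝ) ≤ a (x i j) ∧ a (x i j) ≤ (K j i : ℕ) + 1 - η := by
        by_contra h
        exact hx ⟨hx', h⟩
      have hgx : (g ∘ colwise fun x i => a (x i)) x i j = f (center K) i j :=
        hgK _ K hK i j
      rw [hgx]
      refine hfδ x (center K) (fun i j => ?_) i j
      have hxK : x i j - center K i j = (a (x i j) - (K j i : ℕ)) / κ := by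
        simp only [a, center, Matrix.of_apply]
        field_simp
        ring
      rw [hxK, abs_of_nonneg (div_nonneg (by linarith [(hK i j).1]) hκ.le)]
      refine le_trans ?_ hκδ
      gcongr
      linarith [(hK i j).2]
    · obtain ⟨h₁, h₂⟩ := hout x hx'
      rw [h₁, h₂]
      simpa using hc.le
  · exact (abs_sub _ _).trans (add_le_add (hfC x i j) (hgB _ i j))
  · rw [← ENNReal.ofReal_toReal hbox, ← hV, ← ENNReal.ofReal_mul (by positivity), hcp]
    refine ENNReal.ofReal_le_ofReal ?_
    rw [mul_div_assoc', div_mul_eq_mul_div, div_le_div_iff₀ (by positivity) (by norm_num)]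
    nlinarith
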